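/- Let $\alpha$ be an angle with $98.195^\circ\le\alpha\le 108^\circ$, and let $P_{0,0}\neq P_{0,1}$ be two points of the oriented Euclidean plane. The paperfolding (dragon) polygons $Q_n$, $n\ge 0$, with unfolding angle $\alpha$ are the polygonal lines with vertices $P_{n,0},P_{n,1},\dots,P_{n,2^n}$ and segments $\overline{P_{n,k}P_{n,k+1}}$, $0\le k<2^n$, defined recursively as follows. $Q_0$ is the segment $\overline{P_{0,0}P_{0,1}}$. Given $Q_n$, put $P_{n+1,2k}=P_{n,k}$ for $0\le k\le 2^n$; for $0\le k<2^n$ let $P_{n+1,2k+1}$ be the apex of the isosceles triangle with base $\overline{P_{n,k}P_{n,k+1}}$ and apex angle $\alpha$ that lies, as seen when going from $P_{n,k}$ to $P_{n,k+1}$, to the right of the base if $k$ is even and to the left of it if $k$ is odd. Then for every $n\ge 0$ the polygon $Q_n$ does not intersect itself: for $0\le i<j<2^n$ the closed segments $\overline{P_{n,i}P_{n,i+1}}$ and $\overline{P_{n,j}P_{n,j+1}}$ are disjoint if $j>i+1$, and meet only in the point $P_{n,j}$ if $j=i+1$. -/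

import Mathlib

namespace Paperfolding

/-- The base angle `β = (π - α) / 2` of an isosceles triangle with apex angle `α` (radians). -/
noncomputable def baseAngle (α : ℝ) : ℝ := (Real.pi - α) / 2

/-- The ratio `q = 1 / (2 cos β)` of the leg to the base in such a triangle. -/
noncomputable def legRatio (α : ℝ) : ℝ := 1 / (2 * Real.cos (baseAngle α))

/-- The apex of the isosceles triangle with base `x y` and apex angle `α` that lies to the right
of the base, as seen when going from `x` to `y`: the leg at `x` is the base turned clockwise by
`β` and scaled by `q`. -/
noncomputable def rightApex (α : ℝ) (x y : ℂ) : ℂ :=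
  x + (legRatio α : ℂ) * Complex.exp (-(baseAngle α : ℂ) * Complex.I) * (y - x)

/-- The apex of the isosceles triangle with base `x y` and apex angle `α` that lies to the left
of the base, as seen when going from `x` to `y`. -/
noncomputable def leftApex (α : ℝ) (x y : ℂ) : ℂ :=
  x + (legRatio α : ℂ) * Complex.exp ((baseAngle α : ℂ) * Complex.I) * (y - x)

/-- `vertex a b α n k` is the vertex `P_{n,k}` (`0 ≤ k ≤ 2 ^ n`) of the `n`-th paperfolding polygon
with unfolding angle `α`, first vertex `a` and last vertex `b`. Passing from `n` to `n + 1`, the old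
vertices get the even indices, and the segment from `P_{n,j}` to `P_{n,j+1}` is replaced by the legs
of an isosceles triangle, erected to the right if `j` is even and to the left if `j` is odd, whose
apex becomes `P_{n+1,2j+1}`. (Values for `k > 2 ^ n` play no role.) -/
noncomputable def vertex (a b : ℂ) (α : ℝ) : ℕ → ℕ → ℂ
  | 0, k => if k = 0 then a else b
  | n + 1, k =>
    if Even k then vertex a b α n (k / 2)
    else if Even (k / 2) then
      rightApex α (vertex a b α n (k / 2)) (vertex a b α n (k / 2 + 1))
    else
      leftApex α (vertex a b α n (k / 2)) (vertex a b α n (k / 2 + 1))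

/-- The polygonal line with vertices `P 0, …, P N` does not intersect itself: two distinct closed
segments have no common point, except that consecutive ones meet in their common vertex and
nowhere else. -/
def HasNoSelfIntersection (P : ℕ → ℂ) (N : ℕ) : Prop :=
  ∀ i j : ℕ, i < j → j < N →
    segment ℝ (P i) (P (i + 1)) ∩ segment ℝ (P j) (P (j + 1)) =
      if j = i + 1 then {P j} else ∅

end Paperfolding

/-!
The polygon of order `n + 1` on the base `0 1` consists of two scaled copies of the polygon of
order `n`, namely its images under `w ↦ z w` and (run through backwards) `w ↦ 1 - (1 - z) w`, where
`z = (1 - t i) / 2` with `t = tan β` is the apex of the initial triangle (`mem_unitSegment_succ`).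
By induction each copy does not intersect itself, so the point is that the two copies meet in
their common endpoint `z` only.

Split each copy into two once more. The two quarters next to `z` are images of the same polygon
under `w ↦ z - z (1 - z) w` and `w ↦ z + (1 - z) ^ 2 w`, so at `z` one sees a spiral and its rotation
by the angle `α`; that these meet in the vertex of the spirals only is again proved by induction,
by splitting both of them (`eq_zero_of_corner`). In this way everything is reduced to six pairs of
parts of the polygon that have no point in common at all.

For these, all polygons are enclosed in one hexagon which contains the segment from `0` to `1` and is
invariant under both maps (`InHexagon`); the images of the hexagon in the six pairs are
separated by lines. The bounds on `α` give `5 / 8 < t < 13 / 15`, and a single hexagon serves for all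
these `t`: its invariance is a condition affine in `t`, to be checked at the two endpoints, and each
separation is positivity of a quadratic polynomial in `t`, which follows from that of its Bernstein
coefficients (`quadratic_pos`). Each of these checks is linear arithmetic in the coordinates of the
points.
-/

namespace Paperfolding

open Complex

/-! ### Bounds on the parameter `tan β` -/

lemma lt_tan_baseAngle {α : ℝ} (h₁ : 98.195 * (Real.pi / 180) ≤ α)
    (h₂ : α ≤ 108 * (Real.pi / 180)) : 5 / 8 < Real.tan (baseAngle α) := by
  have hpi := Real.pi_gt_d2
  have h : baseAngle α < Real.tan (baseAngle α) := by
    apply Real.lt_tan <;> unfold baseAngle <;> linarith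
  have : 5 / 8 < baseAngle α := by unfold baseAngle; linarith
  linarith

/-- With `x = π / 4 - β` one has `tan β = (1 - tan x) / (1 + tan x)` and `tan x > x > 0.0715`. -/
lemma tan_baseAngle_lt {α : ℝ} (h₁ : 98.195 * (Real.pi / 180) ≤ α)
    (h₂ : α ≤ 108 * (Real.pi / 180)) : Real.tan (baseAngle α) < 13 / 15 := by
  have hpi := Real.pi_gt_d4
  set x := Real.pi / 4 - baseAngle α with hx
  have hx₀ : 0.0715 < x := by rw [hx]; unfold baseAngle; linarith
  have hx₁ : x < Real.pi / 2 := by rw [hx]; unfold baseAngle; linarith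
  have htan : x < Real.tan x := Real.lt_tan (by linarith) hx₁
  have hcos : 0 < Real.cos x := Real.cos_pos_of_mem_Ioo ⟨by linarith, hx₁⟩
  have hsin : 0.0715 * Real.cos x < Real.sin x := by
    rw [← Real.tan_mul_cos hcos.ne']
    exact mul_lt_mul_of_pos_right (hx₀.trans htan) hcos
  have hβ : baseAngle α = Real.pi / 4 - x := by rw [hx]; ring
  have h2 : 0 < √2 / 2 := by positivity
  have hden : 0 < √2 / 2 * Real.cos x + √2 / 2 * Real.sin x := by
    have : 0 < Real.sin x := by linarith
    positivity
  clear_value x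
  rw [hβ, Real.tan_eq_sin_div_cos, Real.sin_sub, Real.cos_sub, Real.sin_pi_div_four,
    Real.cos_pi_div_four, div_lt_iff₀ hden]
  nlinarith [mul_lt_mul_of_pos_left hsin h2]

/-- The apex of the isosceles triangle on the right of the base `0 1` whose base angle has
tangent `t`. -/
noncomputable def unitApex (t : ℝ) : ℂ := ⟨1 / 2, -t / 2⟩

lemma cos_baseAngle_pos {α : ℝ} (h₀ : 0 < α) (h₁ : α < 2 * Real.pi) :
    0 < Real.cos (baseAngle α) :=
  Real.cos_pos_of_mem_Ioo
    ⟨by unfold baseAngle; linarith, by unfold baseAngle; linarith⟩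

lemma legRatio_mul_exp_neg {α : ℝ} (h : 0 < Real.cos (baseAngle α)) :
    (legRatio α : ℂ) * exp (-(baseAngle α : ℂ) * I) = unitApex (Real.tan (baseAngle α)) := by
  have := h.ne'
  rw [← ofReal_neg, exp_mul_I, ← ofReal_cos, ← ofReal_sin, Real.cos_neg, Real.sin_neg,
    legRatio, Real.tan_eq_sin_div_cos]
  apply Complex.ext <;>
    simp only [unitApex, mul_re, mul_im, add_re, add_im, ofReal_re, ofReal_im, I_re, I_im] <;>
    field_simp <;> ring

lemma legRatio_mul_exp {α : ℝ} (h : 0 < Real.cos (baseAngle α)) :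
    (legRatio α : ℂ) * exp ((baseAngle α : ℂ) * I) =
      1 - unitApex (Real.tan (baseAngle α)) := by
  have := h.ne'
  rw [exp_mul_I, ← ofReal_cos, ← ofReal_sin, legRatio, Real.tan_eq_sin_div_cos]
  apply Complex.ext <;>
    simp only [unitApex, mul_re, mul_im, add_re, add_im, sub_re, sub_im, one_re, one_im,
      ofReal_re, ofReal_im, I_re, I_im] <;>
    field_simp <;> ring

lemma rightApex_eq {α : ℝ} (h : 0 < Real.cos (baseAngle α)) (x y : ℂ) :
    rightApex α x y = x + unitApex (Real.tan (baseAngle α)) * (y - x) := by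
  rw [rightApex, legRatio_mul_exp_neg h]

lemma leftApex_eq_rightApex {α : ℝ} (h : 0 < Real.cos (baseAngle α)) (x y : ℂ) :
    leftApex α x y = rightApex α y x := by
  rw [leftApex, rightApex_eq h, legRatio_mul_exp h]
  ring

/-! ### Self-similarity of the polygons -/

lemma vertex_succ_two_mul (a b : ℂ) (α : ℝ) (n k : ℕ) :
    vertex a b α (n + 1) (2 * k) = vertex a b α n k := by
  simp [vertex]

lemma vertex_succ_two_mul_add_one (a b : ℂ) (α : ℝ) (n k : ℕ) :
    vertex a b α (n + 1) (2 * k + 1) =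
      if Even k then rightApex α (vertex a b α n k) (vertex a b α n (k + 1))
      else leftApex α (vertex a b α n k) (vertex a b α n (k + 1)) := by
  have h : (2 * k + 1) / 2 = k := by omega
  have h' : ¬ Even (2 * k + 1) := by simp
  rw [vertex, if_neg h', h]

/-- The polygon on the base `a b` is an affine copy of the polygon on the base `0 1`. -/
lemma vertex_eq_affine (a b : ℂ) (α : ℝ) (n k : ℕ) :
    vertex a b α n k = a + (b - a) * vertex 0 1 α n k := by
  induction n generalizing k with
  | zero => by_cases h : k = 0 <;> simp [vertex, h]
  | succ n ih =>
    obtain ⟨l, rfl | rfl⟩ := Nat.even_or_odd' k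
    · rw [vertex_succ_two_mul, vertex_succ_two_mul, ih]
    · rw [vertex_succ_two_mul_add_one, vertex_succ_two_mul_add_one, ih l, ih (l + 1)]
      split_ifs <;> simp only [rightApex, leftApex] <;> ring

/-- The first half of a polygon is the polygon of the previous order on the first leg of the
initial triangle. -/
lemma vertex_succ_of_le (a b : ℂ) (α : ℝ) (n k : ℕ) (hk : k ≤ 2 ^ n) :
    vertex a b α (n + 1) k = vertex a (rightApex α a b) α n k := by
  induction n generalizing k with
  | zero =>
    obtain rfl | rfl : k = 0 ∨ k = 1 := by simp at hk; omega
    · simp [vertex]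
    · simp [vertex]
  | succ n ih =>
    rw [pow_succ] at hk
    obtain ⟨l, rfl | rfl⟩ := Nat.even_or_odd' k
    · rw [vertex_succ_two_mul, vertex_succ_two_mul, ih l (by omega)]
    · rw [vertex_succ_two_mul_add_one, vertex_succ_two_mul_add_one, ih l (by omega),
        ih (l + 1) (by omega)]

/-- The second half of a polygon, run through backwards, is the polygon of the previous order on
the second leg of the initial triangle, directed from its last point to the apex. -/
lemma vertex_succ_reverse {α : ℝ} (h : 0 < Real.cos (baseAngle α)) (a b : ℂ) (n k : ℕ)
    (hk : k ≤ 2 ^ n) :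
    vertex a b α (n + 1) (2 ^ (n + 1) - k) = vertex b (rightApex α a b) α n k := by
  induction n generalizing k with
  | zero =>
    obtain rfl | rfl : k = 0 ∨ k = 1 := by simp at hk; omega
    · simp [vertex]
    · simp [vertex]
  | succ n ih =>
    have hpow : 2 ^ (n + 1) = 2 * 2 ^ n := pow_succ' 2 n
    have hpow' : 2 ^ (n + 1 + 1) = 2 * 2 ^ (n + 1) := pow_succ' 2 (n + 1)
    obtain ⟨l, rfl | rfl⟩ := Nat.even_or_odd' k
    · rw [show 2 ^ (n + 1 + 1) - 2 * l = 2 * (2 ^ (n + 1) - l) by omega, vertex_succ_two_mul,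
        vertex_succ_two_mul, ih l (by omega)]
    · have hpar : Even (2 ^ (n + 1) - (l + 1)) ↔ ¬ Even l := by
        rw [Nat.even_sub (by omega), hpow, Nat.even_add_one]
        simp
      rw [show 2 ^ (n + 1 + 1) - (2 * l + 1) = 2 * (2 ^ (n + 1) - (l + 1)) + 1 by omega,
        vertex_succ_two_mul_add_one, vertex_succ_two_mul_add_one,
        show 2 ^ (n + 1) - (l + 1) + 1 = 2 ^ (n + 1) - l by omega, ih l (by omega),
        ih (l + 1) (by omega), if_congr hpar rfl rfl, leftApex_eq_rightApex h,
        leftApex_eq_rightApex h]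
      split_ifs <;> rfl

/-- The `k`-th segment of the `n`-th polygon on the base `0 1`. -/
noncomputable def unitSegment (α : ℝ) (n k : ℕ) : Set ℂ :=
  segment ℝ (vertex 0 1 α n k) (vertex 0 1 α n (k + 1))

lemma exists_eq_of_mem_segment_affine {c d x y p : ℂ}
    (hp : p ∈ segment ℝ (c + d * x) (c + d * y)) : ∃ w ∈ segment ℝ x y, p = c + d * w := by
  obtain ⟨r, s, hr, hs, hrs, rfl⟩ := hp
  refine ⟨r • x + s • y, ⟨r, s, hr, hs, hrs, rfl⟩, ?_⟩
  have : (r : ℂ) + s = 1 := by exact_mod_cast hrs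
  simp only [real_smul]
  linear_combination c * this

lemma unitSegment_zero (α : ℝ) : unitSegment α 0 0 = segment ℝ 0 1 := by
  simp [unitSegment, vertex]

lemma exists_of_mem_unitSegment_zero {α : ℝ} {p : ℂ} (hp : p ∈ unitSegment α 0 0) :
    ∃ r : ℝ, 0 ≤ r ∧ r ≤ 1 ∧ p = r := by
  rw [unitSegment_zero, segment_eq_image'] at hp
  obtain ⟨r, ⟨h₀, h₁⟩, rfl⟩ := hp
  exact ⟨r, h₀, h₁, by simp⟩

lemma vertex_succ_left {α : ℝ} (h : 0 < Real.cos (baseAngle α)) {n k : ℕ} (hk : k ≤ 2 ^ n) :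
    vertex 0 1 α (n + 1) k = unitApex (Real.tan (baseAngle α)) * vertex 0 1 α n k := by
  rw [vertex_succ_of_le _ _ _ _ _ hk, vertex_eq_affine, rightApex_eq h]
  ring

lemma vertex_succ_right {α : ℝ} (h : 0 < Real.cos (baseAngle α)) {n k : ℕ} (hk : k ≤ 2 ^ n) :
    vertex 0 1 α (n + 1) (2 ^ (n + 1) - k) =
      1 - (1 - unitApex (Real.tan (baseAngle α))) * vertex 0 1 α n k := by
  rw [vertex_succ_reverse h _ _ _ _ hk, vertex_eq_affine, rightApex_eq h]
  ring

/-- A point on the polygon of order `n + 1` comes from a point on the polygon of order `n`, by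
`w ↦ z w` in the first half and by `w ↦ 1 - (1 - z) w`, with the order of the segments reversed,
in the second half; here `z` is the apex of the initial triangle. -/
lemma mem_unitSegment_succ {α : ℝ} (h : 0 < Real.cos (baseAngle α)) {n k : ℕ} {p : ℂ}
    (hk : k < 2 ^ (n + 1)) (hp : p ∈ unitSegment α (n + 1) k) :
    (k < 2 ^ n ∧ ∃ w ∈ unitSegment α n k, p = unitApex (Real.tan (baseAngle α)) * w) ∨
    ∃ l < 2 ^ n, l + k + 1 = 2 ^ (n + 1) ∧ ∃ w ∈ unitSegment α n l,
      p = 1 - (1 - unitApex (Real.tan (baseAngle α))) * w := by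
  have hpow : 2 ^ (n + 1) = 2 * 2 ^ n := pow_succ' 2 n
  rcases lt_or_ge k (2 ^ n) with hkn | hkn
  · left
    rw [unitSegment, vertex_succ_left h hkn.le, vertex_succ_left h hkn,
      ← zero_add (_ * vertex 0 1 α n k), ← zero_add (_ * vertex 0 1 α n (k + 1))] at hp
    obtain ⟨w, hw, rfl⟩ := exists_eq_of_mem_segment_affine hp
    exact ⟨hkn, w, hw, zero_add _⟩
  · right
    obtain ⟨l, hl⟩ : ∃ l, l + k + 1 = 2 ^ (n + 1) := ⟨2 ^ (n + 1) - (k + 1), by omega⟩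
    have hl' : l < 2 ^ n := by omega
    rw [unitSegment, show k = 2 ^ (n + 1) - (l + 1) by omega,
      show 2 ^ (n + 1) - (l + 1) + 1 = 2 ^ (n + 1) - l by omega, vertex_succ_right h hl'.le,
      vertex_succ_right h hl', segment_symm] at hp
    simp only [sub_eq_add_neg (1 : ℂ) (_ * _), ← neg_mul] at hp
    obtain ⟨w, hw, rfl⟩ := exists_eq_of_mem_segment_affine hp
    exact ⟨l, hl', hl, w, hw, by ring⟩

/-! ### A hexagon containing all the polygons -/

/-- A convex hexagon that contains the segment from `0` to `1` and is mapped into itself by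
`w ↦ z w` and by `w ↦ 1 - (1 - z) w` for every `z = unitApex t` with `5 / 8 ≤ t ≤ 13 / 15`. -/
structure InHexagon (w : ℂ) : Prop where
  right_up : 26 * w.re + 30 * w.im ≤ 33
  up : 200 * w.im ≤ 51
  left_up : -5 ≤ 20 * w.re + 2 * w.im
  left_down : -29 ≤ 52 * w.re + 60 * w.im
  down : -11 ≤ 20 * w.im
  right_down : 26 * w.re - 30 * w.im ≤ 33

/-- An affine function is nonnegative on an interval if it is so at the endpoints. -/
lemma affine_nonneg {t A B : ℝ} (h₀ : 5 / 8 ≤ t) (h₁ : t ≤ 13 / 15) (hl : 0 ≤ A + B * (5 / 8))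
    (hr : 0 ≤ A + B * (13 / 15)) : 0 ≤ A + B * t := by
  nlinarith [mul_nonneg (sub_nonneg.2 h₀) hr, mul_nonneg (sub_nonneg.2 h₁) hl]

/-- A quadratic function is positive on an interval if its Bernstein coefficients are. -/
lemma quadratic_pos {t : ℝ} (A B C : ℝ) (h₀ : 5 / 8 ≤ t) (h₁ : t ≤ 13 / 15)
    (hl : 0 < A + B * (5 / 8) + C * (5 / 8) ^ 2)
    (hm : 0 < A + B * ((5 / 8 + 13 / 15) / 2) + C * (5 / 8 * (13 / 15)))
    (hr : 0 < A + B * (13 / 15) + C * (13 / 15) ^ 2) : 0 < A + B * t + C * t ^ 2 := by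
  have key : (13 / 15 - 5 / 8 : ℝ) ^ 2 * (A + B * t + C * t ^ 2) =
      (13 / 15 - t) ^ 2 * (A + B * (5 / 8) + C * (5 / 8) ^ 2) +
      2 * ((13 / 15 - t) * (t - 5 / 8)) *
        (A + B * ((5 / 8 + 13 / 15) / 2) + C * (5 / 8 * (13 / 15))) +
      (t - 5 / 8) ^ 2 * (A + B * (13 / 15) + C * (13 / 15) ^ 2) := by ring
  have hpos : 0 < (13 / 15 - 5 / 8 : ℝ) ^ 2 * (A + B * t + C * t ^ 2) := by
    rw [key]
    have h₀' := sub_nonneg.2 h₀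
    have h₁' := sub_nonneg.2 h₁
    rcases h₀.eq_or_lt with rfl | h
    · have : 0 < (13 / 15 - 5 / 8 : ℝ) ^ 2 := by norm_num
      nlinarith
    · have : 0 < t - 5 / 8 := sub_pos.2 h
      positivity
  exact pos_of_mul_pos_right hpos (by positivity)

lemma InHexagon.unitApex_mul {t : ℝ} (h₀ : 5 / 8 ≤ t) (h₁ : t ≤ 13 / 15) {w : ℂ}
    (hw : InHexagon w) : InHexagon (unitApex t * w) := by
  obtain ⟨e₁, e₂, e₃, e₄, e₅, e₆⟩ := hw
  have aux (a b c : ℝ) (hl : 0 ≤ c - a * (w.re + 5 / 8 * w.im) - b * (w.im - 5 / 8 * w.re))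
      (hr : 0 ≤ c - a * (w.re + 13 / 15 * w.im) - b * (w.im - 13 / 15 * w.re)) :
      2 * (a * (unitApex t * w).re + b * (unitApex t * w).im) ≤ c := by
    have := affine_nonneg (A := c - a * w.re - b * w.im) (B := b * w.re - a * w.im) h₀ h₁
      (by linarith) (by linarith)
    simp only [unitApex, mul_re, mul_im]
    linarith
  constructor
  · linarith [aux 26 30 66 (by linarith) (by linarith)]
  · linarith [aux 0 200 102 (by linarith) (by linarith)]
  · linarith [aux (-20) (-2) 10 (by linarith) (by linarith)]
  · linarith [aux (-52) (-60) 58 (by linarith) (by linarith)]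
  · linarith [aux 0 (-20) 22 (by linarith) (by linarith)]
  · linarith [aux 26 (-30) 66 (by linarith) (by linarith)]

lemma InHexagon.one_sub_mul {t : ℝ} (h₀ : 5 / 8 ≤ t) (h₁ : t ≤ 13 / 15) {w : ℂ}
    (hw : InHexagon w) : InHexagon (1 - (1 - unitApex t) * w) := by
  obtain ⟨e₁, e₂, e₃, e₄, e₅, e₆⟩ := hw
  have aux (a b c : ℝ)
      (hl : 0 ≤ c - a * (2 - w.re + 5 / 8 * w.im) + b * (w.im + 5 / 8 * w.re))
      (hr : 0 ≤ c - a * (2 - w.re + 13 / 15 * w.im) + b * (w.im + 13 / 15 * w.re)) :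
      2 * (a * (1 - (1 - unitApex t) * w).re + b * (1 - (1 - unitApex t) * w).im) ≤ c := by
    have := affine_nonneg (A := c - 2 * a + a * w.re + b * w.im) (B := b * w.re - a * w.im) h₀ h₁
      (by linarith) (by linarith)
    simp only [unitApex, mul_re, mul_im, sub_re, sub_im, one_re, one_im]
    linarith
  constructor
  · linarith [aux 26 30 66 (by linarith) (by linarith)]
  · linarith [aux 0 200 102 (by linarith) (by linarith)]
  · linarith [aux (-20) (-2) 10 (by linarith) (by linarith)]
  · linarith [aux (-52) (-60) 58 (by linarith) (by linarith)]
  · linarith [aux 0 (-20) 22 (by linarith) (by linarith)]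
  · linarith [aux 26 (-30) 66 (by linarith) (by linarith)]

/-! ### Separation of non-adjacent parts -/

/-! In the names, `l` and `r` stand for the maps `w ↦ z w` and `w ↦ 1 - (1 - z) w` whose images contain
the left and the right half of the polygon. In the `corner` lemmas `(1 - z) q = -(z p)` says that `q`
is `p` rotated by the angle `α` about `0`. -/

section Separation

variable {t : ℝ} {p q : ℂ}

lemma ll_ne_rl (h₀ : 5 / 8 ≤ t) (h₁ : t ≤ 13 / 15) (hp : InHexagon p) (hq : InHexagon q) :
    unitApex t * (unitApex t * p) ≠ 1 - (1 - unitApex t) * (unitApex t * q) := by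
  intro h
  obtain ⟨e₁, e₂, e₃, e₄, e₅, e₆⟩ := hp
  obtain ⟨d₁, d₂, d₃, d₄, d₅, d₆⟩ := hq
  have hre := congrArg re h
  simp only [unitApex, mul_re, mul_im, sub_re, sub_im, one_re, one_im] at hre
  have := quadratic_pos (4 - q.re - p.re)
    (-2 * p.im) (p.re - q.re) h₀ h₁
    (by linarith) (by linarith) (by linarith)
  linarith

lemma ll_ne_rr (h₀ : 5 / 8 ≤ t) (h₁ : t ≤ 13 / 15) (hp : InHexagon p) (hq : InHexagon q) :
    unitApex t * (unitApex t * p) ≠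
      1 - (1 - unitApex t) * (1 - (1 - unitApex t) * q) := by
  intro h
  obtain ⟨e₁, e₂, e₃, e₄, e₅, e₆⟩ := hp
  obtain ⟨d₁, d₂, d₃, d₄, d₅, d₆⟩ := hq
  have hre := congrArg re h
  simp only [unitApex, mul_re, mul_im, sub_re, sub_im, one_re, one_im] at hre
  have := quadratic_pos (2 + q.re - p.re)
    (-2 * q.im - 2 * p.im) (p.re - q.re) h₀ h₁
    (by linarith) (by linarith) (by linarith)
  linarith

lemma lr_ne_rl (h₀ : 5 / 8 ≤ t) (h₁ : t ≤ 13 / 15) (hp : InHexagon p) (hq : InHexagon q) :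
    unitApex t * (1 - (1 - unitApex t) * p) ≠ 1 - (1 - unitApex t) * (unitApex t * q) := by
  intro h
  obtain ⟨e₁, e₂, e₃, e₄, e₅, e₆⟩ := hp
  obtain ⟨d₁, d₂, d₃, d₄, d₅, d₆⟩ := hq
  have hre := congrArg re h
  have him := congrArg im h
  simp only [unitApex, mul_re, mul_im, sub_re, sub_im, one_re, one_im] at hre him
  have := quadratic_pos (2 - q.re + p.re + p.im - q.im)
    2 (p.re - q.re + p.im - q.im) h₀ h₁
    (by linarith) (by linarith) (by linarith)
  linarith

lemma corner_l_ne_r (h₀ : 5 / 8 ≤ t) (h₁ : t ≤ 13 / 15) (hp : InHexagon p) (hq : InHexagon q) :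
    (1 - unitApex t) * (1 - (1 - unitApex t) * q) ≠ -(unitApex t * (unitApex t * p)) := by
  intro h
  obtain ⟨e₁, e₂, e₃, e₄, e₅, e₆⟩ := hp
  obtain ⟨d₁, d₂, d₃, d₄, d₅, d₆⟩ := hq
  have hre := congrArg re h
  have him := congrArg im h
  simp only [unitApex, mul_re, mul_im, sub_re, sub_im, neg_re, neg_im, one_re, one_im] at hre him
  -- The narrowest gap of the six: the functional `7 re + im` is chosen close to its direction.
  have := quadratic_pos (7 * (2 - q.re + p.re) + (p.im - q.im))
    (7 * (2 * q.im + 2 * p.im) + (2 - 2 * q.re - 2 * p.re)) (7 * (q.re - p.re) + (q.im - p.im)) h₀ h₁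
    (by linarith) (by linarith) (by linarith)
  linarith

/-- A factor `unitApex t` common to both sides has been cancelled. -/
lemma corner_r_ne_l (h₀ : 5 / 8 ≤ t) (h₁ : t ≤ 13 / 15) (hp : InHexagon p) (hq : InHexagon q) :
    (1 - unitApex t) * q ≠ -(1 - (1 - unitApex t) * p) := by
  intro h
  obtain ⟨e₁, e₂, e₃, e₄, e₅, e₆⟩ := hp
  obtain ⟨d₁, d₂, d₃, d₄, d₅, d₆⟩ := hq
  have hre := congrArg re h
  simp only [unitApex, mul_re, sub_re, sub_im, neg_re, one_re, one_im] at hre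
  have := quadratic_pos (2 + q.re - p.re)
    (p.im - q.im) 0 h₀ h₁
    (by linarith) (by linarith) (by linarith)
  linarith

lemma corner_r_ne_r (h₀ : 5 / 8 ≤ t) (h₁ : t ≤ 13 / 15) (hp : InHexagon p) (hq : InHexagon q) :
    (1 - unitApex t) * (1 - (1 - unitApex t) * q) ≠
      -(unitApex t * (1 - (1 - unitApex t) * p)) := by
  intro h
  obtain ⟨e₁, e₂, e₃, e₄, e₅, e₆⟩ := hp
  obtain ⟨d₁, d₂, d₃, d₄, d₅, d₆⟩ := hq
  have hre := congrArg re h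
  simp only [unitApex, mul_re, mul_im, sub_re, sub_im, neg_re, one_re, one_im] at hre
  have := quadratic_pos (4 - q.re - p.re)
    (2 * q.im) (q.re - p.re) h₀ h₁
    (by linarith) (by linarith) (by linarith)
  linarith

end Separation

lemma inHexagon_of_mem_unitSegment {α : ℝ} (h : 0 < Real.cos (baseAngle α))
    (h₀ : 5 / 8 ≤ Real.tan (baseAngle α)) (h₁ : Real.tan (baseAngle α) ≤ 13 / 15) {n k : ℕ} {p : ℂ}
    (hk : k < 2 ^ n) (hp : p ∈ unitSegment α n k) : InHexagon p := by
  induction n generalizing k p with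
  | zero =>
    obtain rfl : k = 0 := by simpa using hk
    obtain ⟨r, hr₀, hr₁, rfl⟩ := exists_of_mem_unitSegment_zero hp
    constructor <;> simp only [ofReal_re, ofReal_im] <;> linarith
  | succ n ih =>
    obtain ⟨hk', w, hw, rfl⟩ | ⟨l, hl, -, w, hw, rfl⟩ := mem_unitSegment_succ h hk hp
    · exact (ih hk' hw).unitApex_mul h₀ h₁
    · exact (ih hl hw).one_sub_mul h₀ h₁

/-! ### Adjacent parts -/

lemma unitApex_ne_zero (t : ℝ) : unitApex t ≠ 0 := fun h => by
  simpa [unitApex] using congrArg re h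

lemma one_sub_unitApex_ne_zero (t : ℝ) : 1 - unitApex t ≠ 0 := fun h => by
  have := congrArg re h
  norm_num [unitApex] at this

/-- A polygon and its rotation about its first vertex by the angle `α` have only this vertex in
common: since `-z / (1 - z) = exp (i α)`, the hypothesis `hpq` says that `q` is the point `p` rotated
by `α`. -/
lemma eq_zero_of_corner {α : ℝ} (h : 0 < Real.cos (baseAngle α))
    (h₀ : 5 / 8 ≤ Real.tan (baseAngle α)) (h₁ : Real.tan (baseAngle α) ≤ 13 / 15) {n i j : ℕ}
    {p q : ℂ} (hi : i < 2 ^ n) (hj : j < 2 ^ n) (hp : p ∈ unitSegment α n i)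
    (hq : q ∈ unitSegment α n j)
    (hpq : (1 - unitApex (Real.tan (baseAngle α))) * q =
      -(unitApex (Real.tan (baseAngle α)) * p)) : p = 0 ∧ i = 0 ∧ j = 0 := by
  have hz := unitApex_ne_zero (Real.tan (baseAngle α))
  induction n generalizing i j p q with
  | zero =>
    obtain rfl : i = 0 := by simpa using hi
    obtain rfl : j = 0 := by simpa using hj
    obtain ⟨r, hr₀, hr₁, rfl⟩ := exists_of_mem_unitSegment_zero hp
    obtain ⟨s, hs₀, hs₁, rfl⟩ := exists_of_mem_unitSegment_zero hq
    have hre := congrArg re hpq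
    simp only [unitApex, mul_re, sub_re, sub_im, neg_re, one_re, one_im, ofReal_re,
      ofReal_im] at hre
    obtain rfl : r = 0 := by linarith
    simp
  | succ n ih =>
    have hex {k : ℕ} {w : ℂ} (hk : k < 2 ^ n) (hw : w ∈ unitSegment α n k) : InHexagon w :=
      inHexagon_of_mem_unitSegment h h₀ h₁ hk hw
    obtain ⟨hi', u, hu, rfl⟩ | ⟨i', hi', -, u, hu, rfl⟩ := mem_unitSegment_succ h hi hp <;>
    obtain ⟨hj', v, hv, rfl⟩ | ⟨j', hj', -, v, hv, rfl⟩ := mem_unitSegment_succ h hj hq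
    · obtain ⟨rfl, rfl, rfl⟩ := ih hi' hj' hu hv
        (mul_left_cancel₀ hz (by linear_combination hpq))
      simp
    · exact absurd hpq (corner_l_ne_r h₀ h₁ (hex hi' hu) (hex hj' hv))
    · exact absurd (mul_left_cancel₀ hz (by linear_combination hpq))
        (corner_r_ne_l h₀ h₁ (hex hi' hu) (hex hj' hv))
    · exact absurd hpq (corner_r_ne_r h₀ h₁ (hex hi' hu) (hex hj' hv))

/-- The two halves of a polygon have only the apex of the initial triangle in common. -/
lemma eq_one_of_apex {α : ℝ} (h : 0 < Real.cos (baseAngle α))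
    (h₀ : 5 / 8 ≤ Real.tan (baseAngle α)) (h₁ : Real.tan (baseAngle α) ≤ 13 / 15) {n i j : ℕ}
    {p q : ℂ} (hi : i < 2 ^ n) (hj : j < 2 ^ n) (hp : p ∈ unitSegment α n i)
    (hq : q ∈ unitSegment α n j)
    (hpq : unitApex (Real.tan (baseAngle α)) * p =
      1 - (1 - unitApex (Real.tan (baseAngle α))) * q) :
    p = 1 ∧ i + 1 = 2 ^ n ∧ j + 1 = 2 ^ n := by
  cases n with
  | zero =>
    obtain rfl : i = 0 := by simpa using hi
    obtain rfl : j = 0 := by simpa using hj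
    obtain ⟨r, hr₀, hr₁, rfl⟩ := exists_of_mem_unitSegment_zero hp
    obtain ⟨s, hs₀, hs₁, rfl⟩ := exists_of_mem_unitSegment_zero hq
    have hre := congrArg re hpq
    simp only [unitApex, mul_re, sub_re, sub_im, one_re, one_im, ofReal_re, ofReal_im] at hre
    obtain rfl : r = 1 := by linarith
    simp
  | succ n =>
    have hex {k : ℕ} {w : ℂ} (hk : k < 2 ^ n) (hw : w ∈ unitSegment α n k) : InHexagon w :=
      inHexagon_of_mem_unitSegment h h₀ h₁ hk hw
    obtain ⟨hi', u, hu, rfl⟩ | ⟨i', hi', hii', u, hu, rfl⟩ := mem_unitSegment_succ h hi hp <;>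
    obtain ⟨hj', v, hv, rfl⟩ | ⟨j', hj', hjj', v, hv, rfl⟩ := mem_unitSegment_succ h hj hq
    · exact absurd hpq (ll_ne_rl h₀ h₁ (hex hi' hu) (hex hj' hv))
    · exact absurd hpq (ll_ne_rr h₀ h₁ (hex hi' hu) (hex hj' hv))
    · exact absurd hpq (lr_ne_rl h₀ h₁ (hex hi' hu) (hex hj' hv))
    · have hz := one_sub_unitApex_ne_zero (Real.tan (baseAngle α))
      obtain ⟨rfl, rfl, rfl⟩ := eq_zero_of_corner h h₀ h₁ hi' hj' hu hv
        (mul_left_cancel₀ hz (by linear_combination -hpq))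
      exact ⟨by simp, by omega, by omega⟩

/-! ### Absence of self-intersections -/

lemma vertex_zero_one_last (α : ℝ) (n : ℕ) : vertex 0 1 α n (2 ^ n) = 1 := by
  induction n with
  | zero => simp [vertex]
  | succ n ih => rw [pow_succ', vertex_succ_two_mul, ih]

lemma eq_vertex_of_mem_unitSegment {α : ℝ} (h : 0 < Real.cos (baseAngle α))
    (h₀ : 5 / 8 ≤ Real.tan (baseAngle α)) (h₁ : Real.tan (baseAngle α) ≤ 13 / 15) {n i j : ℕ}
    {p : ℂ} (hij : i < j) (hj : j < 2 ^ n) (hpi : p ∈ unitSegment α n i)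
    (hpj : p ∈ unitSegment α n j) : j = i + 1 ∧ p = vertex 0 1 α n j := by
  have hz := unitApex_ne_zero (Real.tan (baseAngle α))
  have hz' := one_sub_unitApex_ne_zero (Real.tan (baseAngle α))
  induction n generalizing i j p with
  | zero => simp at hj; omega
  | succ n ih =>
    have hpow : 2 ^ (n + 1) = 2 * 2 ^ n := pow_succ' 2 n
    obtain ⟨hi', u, hu, rfl⟩ | ⟨i', hi', hii', u, hu, rfl⟩ :=
      mem_unitSegment_succ h (hij.trans hj) hpi <;>
    obtain ⟨hj', v, hv, huv⟩ | ⟨j', hj', hjj', v, hv, huv⟩ := mem_unitSegment_succ h hj hpj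
    · obtain rfl := mul_left_cancel₀ hz huv
      obtain ⟨hji, rfl⟩ := ih hij hj' hu hv
      exact ⟨hji, (vertex_succ_left h hj'.le).symm⟩
    · obtain ⟨rfl, hi₁, hj₁⟩ := eq_one_of_apex h h₀ h₁ hi' hj' hu hv huv
      obtain rfl : j = 2 ^ n := by omega
      refine ⟨hi₁.symm, ?_⟩
      rw [vertex_succ_left h le_rfl, vertex_zero_one_last]
    · omega
    · obtain rfl := mul_left_cancel₀ hz' (sub_right_injective huv)
      -- the second half is run through backwards, so the order of the indices is reversed
      obtain ⟨hji, rfl⟩ := ih (by omega : j' < i') hi' hv hu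
      refine ⟨by omega, ?_⟩
      rw [show j = 2 ^ (n + 1) - i' by omega, vertex_succ_right h hi'.le]

end Paperfolding

open Paperfolding in
theorem theorem1 (α : ℝ) (hα₁ : 98.195 * (Real.pi / 180) ≤ α) (hα₂ : α ≤ 108 * (Real.pi / 180))
    (a b : ℂ) (hab : a ≠ b) (n : ℕ) :
    Paperfolding.HasNoSelfIntersection (Paperfolding.vertex a b α n) (2 ^ n) := by
  have hpi := Real.pi_pos
  have h : 0 < Real.cos (baseAngle α) := cos_baseAngle_pos (by linarith) (by linarith)
  have h₀ := (lt_tan_baseAngle hα₁ hα₂).le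
  have h₁ := (tan_baseAngle_lt hα₁ hα₂).le
  have hba : b - a ≠ 0 := sub_ne_zero.2 hab.symm
  have key {i j : ℕ} {p : ℂ} (hij : i < j) (hj : j < 2 ^ n)
      (hpi : p ∈ segment ℝ (vertex a b α n i) (vertex a b α n (i + 1)))
      (hpj : p ∈ segment ℝ (vertex a b α n j) (vertex a b α n (j + 1))) :
      j = i + 1 ∧ p = vertex a b α n j := by
    rw [vertex_eq_affine a b α n i, vertex_eq_affine a b α n (i + 1)] at hpi
    rw [vertex_eq_affine a b α n j, vertex_eq_affine a b α n (j + 1)] at hpj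
    obtain ⟨u, hu, rfl⟩ := exists_eq_of_mem_segment_affine hpi
    obtain ⟨v, hv, huv⟩ := exists_eq_of_mem_segment_affine hpj
    obtain rfl := mul_left_cancel₀ hba (add_left_cancel huv)
    obtain ⟨hji, rfl⟩ := eq_vertex_of_mem_unitSegment h h₀ h₁ hij hj hu hv
    exact ⟨hji, (vertex_eq_affine a b α n j).symm⟩
  intro i j hij hj
  split_ifs with hji
  · subst hji
    refine Set.eq_singleton_iff_unique_mem.2 ⟨⟨right_mem_segment .., left_mem_segment ..⟩, ?_⟩
    rintro p ⟨hpi, hpj⟩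
    exact (key hij hj hpi hpj).2
  · refine Set.eq_empty_iff_forall_notMem.2 ?_
    rintro p ⟨hpi, hpj⟩
    exact hji (key hij hj hpi hpj).1
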